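/- Let $d\in\mathbb N$, $r\in[1,\infty)$, $\boldsymbol\sigma=(\sigma_1,\dots,\sigma_d)$ and $\boldsymbol\delta=(\delta_1,\dots,\delta_d)$ with $\sigma_\ell>0$, $\delta_\ell>0$ for $\ell=1,\dots,d$. Let $B^r_{\boldsymbol\sigma,d}$ (the Bernstein class) denote the set of entire functions $f:\mathbb C^d\to\mathbb C$ of exponential type at most $\boldsymbol\sigma$ coordinatewise, that is, such that for every $\varepsilon>0$ there is a constant $A_\varepsilon$ with $$|f(z)|\le A_\varepsilon \exp\Big(\sum_{\ell=1}^d(\sigma_\ell+\varepsilon)|z_\ell|\Big)\qquad\text{for all } z\in\mathbb C^d,$$ whose restriction to $\mathbb R^d$ belongs to $L^r(\mathbb R^d)$. For each $\ell=1,\dots,d$ let $(t^{(\ell)}_n)_{n\in\mathbb Z}$ be a real sequence with $\inf_{n\ne m}|t^{(\ell)}_n-t^{(\ell)}_m|\ge\delta_\ell$, and for $\mathbf n=(n_1,\dots,n_d)\in\mathbb Z^d$ put $t_{\mathbf n}=(t^{(1)}_{n_1},\dots,t^{(d)}_{n_d})\in\mathbb R^d$. Then for every $f\in B^r_{\boldsymbol\sigma,d}$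 the series below converges and $$\sum_{\mathbf n\in\mathbb Z^d}|f(t_{\mathbf n})|^r\le \mathfrak B_{d,r}\,\|f\|_r^r,\qquad \mathfrak B_{d,r}=\Big(\frac{8}{r\pi}\Big)^d\prod_{\ell=1}^d\frac{e^{r\delta_\ell\sigma_\ell/2}-1}{\sigma_\ell\delta_\ell^2},$$ where $\|f\|_r$ is the $L^r(\mathbb R^d)$-norm of the restriction of $f$ to $\mathbb R^d$ (Lebesgue measure). -/

import Mathlib

open MeasureTheory

/-- An entire function `f` on `ℂ^d` is of exponential type at most `σ = (σ_1, …, σ_d)`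
coordinatewise: for every `ε > 0` there is a constant `A` with
`|f z| ≤ A * exp (∑ j, (σ_j + ε) |z_j|)` for all `z`. -/
def IsOfExpTypeAtMost {d : ℕ} (σ : Fin d → ℝ) (f : (Fin d → ℂ) → ℂ) : Prop :=
  Differentiable ℂ f ∧
    ∀ ε : ℝ, 0 < ε → ∃ A : ℝ, ∀ z : Fin d → ℂ,
      ‖f z‖ ≤ A * Real.exp (∑ j, (σ j + ε) * ‖z j‖)

/-- The restriction to `ℝ^d` of a function on `ℂ^d`. -/
def realRestrict {d : ℕ} (f : (Fin d → ℂ) → ℂ) : (Fin d → ℝ) → ℂ :=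
  fun x => f (fun j => (x j : ℂ))

/-- The Bernstein class `B^r_{σ,d}`: entire functions of `d` complex variables of exponential type
at most `σ` coordinatewise, whose restriction to `ℝ^d` is in `L^r(ℝ^d)` (Lebesgue measure). -/
def BernsteinClass {d : ℕ} (σ : Fin d → ℝ) (r : ℝ) : Set ((Fin d → ℂ) → ℂ) :=
  {f | IsOfExpTypeAtMost σ f ∧ MemLp (realRestrict f) (ENNReal.ofReal r) volume}

/-- The constant `𝔅_{d,r} = (8 / (r π))^d ∏_ℓ (e^{r δ_ℓ σ_ℓ / 2} - 1) / (σ_ℓ δ_ℓ ^ 2)`. -/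
noncomputable def plancherelPolyaConst {d : ℕ} (σ δ : Fin d → ℝ) (r : ℝ) : ℝ :=
  (8 / (r * Real.pi)) ^ d *
    ∏ l, (Real.exp (r * δ l * σ l / 2) - 1) / (σ l * δ l ^ 2)

/-! Since `|f|^r` is plurisubharmonic, its value at `t_n` is at most its mean over the polydisc
centred there with radii `δ_l / 2`. Separation makes these polydiscs disjoint, and all lie in the
tube `|Im z_l| < δ_l / 2`, so the sum is at most the integral of `|f|^r` over the tube divided by
the volume `∏ π δ_l² / 4`. By Fubini the tube integral splits over the imaginary part `y`. The
Plancherel–Pólya inequality bounds each slice by `exp (r ∑ σ_l |y_l|)` times the integral over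
`ℝ^d`, and integrating this factor over the box gives the constant. The slice bound reduces to one
variable by duality: `w ↦ ∫_K f(x + w y) φ(x) dx` is entire of exponential type at most `∑ σ_l
|y_l|`, so Phragmén–Lindelöf compares its value at `I` with its bound on the real line. -/

/-! ### One-variable tools: Phragmén–Lindelöf and holomorphic integrals -/

open Set Filter Topology Metric in
/-- An entire function on `ℂ` of exponential type at most `τ` that is bounded by `M` on the real
line is bounded by `exp τ * M` at `I`. -/
theorem norm_apply_I_le_exp_mul {F : ℂ → ℂ} (hF : Differentiable ℂ F) {τ M : ℝ}
    (hexp : ∀ ε : ℝ, 0 < ε → ∃ A : ℝ, ∀ w, ‖F w‖ ≤ A * Real.exp ((τ + ε) * ‖w‖))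
    (hM : ∀ x : ℝ, ‖F x‖ ≤ M) : ‖F Complex.I‖ ≤ Real.exp τ * M := by
  have key : ∀ ε : ℝ, 0 < ε → ‖F Complex.I‖ ≤ Real.exp (τ + ε) * M := by
    intro ε hε
    obtain ⟨A, hA⟩ := hexp ε hε
    have hA0 : 0 ≤ A := by simpa using (norm_nonneg _).trans (hA 0)
    -- The rotation by `I` moves the upper half-plane to the right one. The exponential cancels the
    -- growth of `F` on the positive real axis and has modulus one on the imaginary axis.
    set G : ℂ → ℂ := fun w => Complex.exp (-((τ + ε : ℝ) : ℂ) * w) * F (Complex.I * w) with hG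
    have hGn : ∀ w, ‖G w‖ = Real.exp (-(τ + ε) * w.re) * ‖F (Complex.I * w)‖ := by
      intro w
      rw [hG, norm_mul, Complex.norm_exp, ← Complex.ofReal_neg, Complex.re_ofReal_mul]
    have hGd : Differentiable ℂ G := by
      rw [hG]
      fun_prop
    have h1 : ‖G 1‖ ≤ M := by
      refine PhragmenLindelof.right_half_plane_of_bounded_on_real hGd.diffContOnCl
        ⟨1, by norm_num, 2 * |τ + ε|, ?_⟩ ?_ ?_ (by simp)
      · refine Asymptotics.IsBigO.of_bound A (Eventually.of_forall fun w => ?_)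
        rw [hGn, Real.norm_of_nonneg (Real.exp_pos _).le, Real.rpow_one]
        have e1 : Real.exp (-(τ + ε) * w.re) ≤ Real.exp (|τ + ε| * ‖w‖) := by
          refine Real.exp_le_exp.2 ((le_abs_self _).trans ?_)
          rw [abs_mul, abs_neg]
          exact mul_le_mul_of_nonneg_left (Complex.abs_re_le_norm w) (abs_nonneg _)
        have e2 : Real.exp ((τ + ε) * ‖w‖) ≤ Real.exp (|τ + ε| * ‖w‖) :=
          Real.exp_le_exp.2 (mul_le_mul_of_nonneg_right (le_abs_self _) (norm_nonneg _))
        have e3 := hA (Complex.I * w)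
        rw [norm_mul, Complex.norm_I, one_mul] at e3
        calc _ ≤ Real.exp (|τ + ε| * ‖w‖) * (A * Real.exp (|τ + ε| * ‖w‖)) := by
              gcongr
              exact e3.trans (by gcongr)
          _ = A * Real.exp (2 * |τ + ε| * ‖w‖) := by
            rw [mul_left_comm, ← Real.exp_add]
            ring_nf
      · refine isBoundedUnder_of_eventually_le (a := A) ?_
        filter_upwards [eventually_ge_atTop 0] with x hx
        rw [hGn]
        have e3 := hA (Complex.I * x)
        rw [norm_mul, Complex.norm_I, one_mul, Complex.norm_of_nonneg hx] at e3
        calc _ ≤ Real.exp (-(τ + ε) * x) * (A * Real.exp ((τ + ε) * x)) := by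
              rw [Complex.ofReal_re]; gcongr
          _ = A := by
            rw [mul_left_comm, ← Real.exp_add, neg_mul, neg_add_cancel, Real.exp_zero, mul_one]
      · intro x
        rw [hGn]
        have : Complex.I * (x * Complex.I) = ((-x : ℝ) : ℂ) := by
          rw [mul_left_comm, Complex.I_mul_I]; push_cast; ring
        rw [this]
        simpa using hM (-x)
    rw [hGn, mul_one] at h1
    simp only [Complex.one_re, mul_one] at h1
    calc ‖F Complex.I‖ = Real.exp (τ + ε) * (Real.exp (-(τ + ε)) * ‖F Complex.I‖) := by
          rw [← mul_assoc, ← Real.exp_add]; simp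
      _ ≤ _ := by gcongr
  have hlim : Tendsto (fun ε : ℝ => Real.exp (τ + ε) * M) (𝓝[>] 0) (𝓝 (Real.exp τ * M)) := by
    refine Tendsto.mono_left ?_ nhdsWithin_le_nhds
    exact Continuous.tendsto' (by fun_prop) _ _ (by simp)
  exact ge_of_tendsto hlim (eventually_nhdsWithin_of_forall fun ε hε => key ε hε)

open Metric in
/-- Integrating a jointly continuous family of entire functions over a compact set against an
integrable weight gives an entire function. -/
theorem differentiable_setIntegral_mul {d : ℕ} {h : (Fin d → ℝ) → ℂ → ℂ}
    (hc : Continuous h.uncurry) (hd : ∀ x, Differentiable ℂ (h x)) {K : Set (Fin d → ℝ)}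
    (hK : IsCompact K) {φ : (Fin d → ℝ) → ℂ} (hφ : IntegrableOn φ K) :
    Differentiable ℂ fun w => ∫ x in K, h x w * φ x := by
  intro w₀
  -- Radius 2 contains every unit circle centred in the unit ball around `w₀`, which is what the
  -- Cauchy estimate for the derivative needs.
  obtain ⟨C, hC⟩ := (hK.prod (isCompact_closedBall w₀ 2)).exists_bound_of_continuousOn
    hc.continuousOn
  have hcw : ∀ w, Continuous fun x => h x w := fun w =>
    hc.comp (continuous_id.prodMk continuous_const)
  have hint : ∀ w, IntegrableOn (fun x => h x w * φ x) K := fun w =>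
    hφ.continuousOn_mul (hcw w).continuousOn hK
  have hmeas : Measurable fun x => deriv (h x) w₀ :=
    (measurable_deriv_with_param hc).comp (measurable_id.prodMk measurable_const)
  refine (hasDerivAt_integral_of_dominated_loc_of_deriv_le (μ := volume.restrict K)
    (F := fun w x => h x w * φ x) (F' := fun w x => deriv (h x) w * φ x)
    (bound := fun x => C * ‖φ x‖) (ball_mem_nhds w₀ one_pos)
    (Filter.Eventually.of_forall fun w => (hint w).aestronglyMeasurable) (hint w₀)
    (hmeas.aestronglyMeasurable.mul hφ.aestronglyMeasurable) ?_ (hφ.norm.const_mul C)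
    ?_).2.differentiableAt
  · filter_upwards [ae_restrict_mem hK.measurableSet] with x hx w hw
    rw [norm_mul]
    refine mul_le_mul_of_nonneg_right ?_ (norm_nonneg _)
    have := Complex.norm_deriv_le_of_forall_mem_sphere_norm_le (c := w) (R := 1) (C := C)
      one_pos (hd x).diffContOnCl fun z hz => hC (x, z) ⟨hx, ?_⟩
    · simpa using this
    · rw [mem_closedBall]
      rw [mem_sphere] at hz
      rw [mem_ball] at hw
      linarith [dist_triangle z w w₀]
  · exact Filter.Eventually.of_forall fun x w _ => ((hd x w).hasDerivAt).mul_const _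

/-! ### Sub-mean value inequality on polydiscs -/

/-- The mean value property of entire functions over the unit circle, as an integral against a
probability measure. -/
theorem exists_isProbabilityMeasure_apply_zero_eq_integral :
    ∃ μ : Measure ℝ, IsProbabilityMeasure μ ∧
      ∀ h : ℂ → ℂ, Differentiable ℂ h → h 0 = ∫ θ, h (circleMap 0 1 θ) ∂μ := by
  refine ⟨(ENNReal.ofReal (2 * Real.pi))⁻¹ • volume.restrict (Set.Ioc 0 (2 * Real.pi)), ⟨?_⟩, ?_⟩
  · simp only [Measure.smul_apply, Measure.restrict_apply_univ, Real.volume_Ioc, smul_eq_mul,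
      sub_zero]
    exact ENNReal.inv_mul_cancel (by simp [Real.pi_pos]) ENNReal.ofReal_ne_top
  · intro h hh
    have := (hh.diffContOnCl (s := Metric.ball 0 |(1 : ℝ)|)).circleAverage
    rw [← this, Real.circleAverage, intervalIntegral.integral_of_le Real.two_pi_pos.le,
      integral_smul_measure, ENNReal.toReal_inv, ENNReal.toReal_ofReal Real.two_pi_pos.le]

/-- The `r`-th power of the modulus of an entire function satisfies the sub-mean value inequality
over polydiscs. -/
theorem enorm_rpow_mul_volume_polydisc_le {d : ℕ} {f : (Fin d → ℂ) → ℂ} (hf : Differentiable ℂ f)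
    {r : ℝ} (hr : 1 ≤ r) (t : Fin d → ℂ) (ρ : Fin d → ℝ) :
    ‖f t‖ₑ ^ r * volume (Set.univ.pi fun l => Metric.ball (t l) (ρ l)) ≤
      ∫⁻ z in Set.univ.pi fun l => Metric.ball (t l) (ρ l), ‖f z‖ₑ ^ r := by
  obtain ⟨μ, hμ, hmean⟩ := exists_isProbabilityMeasure_apply_zero_eq_integral
  have hr0 : 0 < r := by linarith
  set P : Set (Fin d → ℂ) := Set.univ.pi fun l => Metric.ball (t l) (ρ l) with hP
  have hPm : MeasurableSet P := MeasurableSet.univ_pi fun l => measurableSet_ball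
  have hcf := hf.continuous
  -- Mean value property on the complex line through `t` and `z`, then `L¹ ≤ L^r` for a probability
  -- measure.
  have hpt : ∀ z : Fin d → ℂ,
      ‖f t‖ₑ ^ r ≤ ∫⁻ θ, ‖f (t + circleMap 0 1 θ • (z - t))‖ₑ ^ r ∂μ := by
    intro z
    have h1 := hmean (fun w => f (t + w • (z - t))) (by fun_prop)
    simp only [zero_smul, add_zero] at h1
    have hm : Continuous fun θ => f (t + circleMap 0 1 θ • (z - t)) := by fun_prop
    have h2 : ‖f t‖ₑ ≤ eLpNorm (fun θ => f (t + circleMap 0 1 θ • (z - t))) 1 μ := by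
      rw [eLpNorm_one_eq_lintegral_enorm, h1]
      exact enorm_integral_le_lintegral_enorm _
    have h3 := h2.trans (eLpNorm_le_eLpNorm_of_exponent_le (q := ENNReal.ofReal r)
      (by simpa using hr) hm.aestronglyMeasurable)
    rw [eLpNorm_eq_lintegral_rpow_enorm_toReal (by simpa using hr0) ENNReal.ofReal_ne_top,
      ENNReal.toReal_ofReal hr0.le, one_div] at h3
    exact (ENNReal.le_rpow_inv_iff hr0).1 h3
  -- Turning all coordinates about `t` by one angle preserves both volume and the polydisc.
  have hrot : ∀ θ : ℝ, ∫⁻ z in P, ‖f (t + circleMap 0 1 θ • (z - t))‖ₑ ^ r =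
      ∫⁻ z in P, ‖f z‖ₑ ^ r := by
    intro θ
    have hmp : MeasurePreserving
        (fun z : Fin d → ℂ => fun l => t l + rotation (Circle.exp θ) (z l - t l)) := by
      refine volume_preserving_pi
        (f := fun l (z : ℂ) => t l + rotation (Circle.exp θ) (z - t l)) fun l => ?_
      exact (measurePreserving_add_left volume (t l)).comp
        ((rotation (Circle.exp θ)).measurePreserving.comp
          (measurePreserving_sub_right volume (t l)))
    have hpre : (fun z : Fin d → ℂ => fun l => t l + rotation (Circle.exp θ) (z l - t l)) ⁻¹' P
        = P := by
      ext z
      simp [hP, Set.mem_pi, dist_eq_norm]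
    have := hmp.setLIntegral_comp_preimage hPm (f := fun z => ‖f z‖ₑ ^ r)
      (by fun_prop)
    rw [hpre] at this
    rw [← this]
    refine lintegral_congr fun z => ?_
    congr 3
    ext l
    simp [rotation_apply, circleMap, Circle.coe_exp]
  calc ‖f t‖ₑ ^ r * volume P = ∫⁻ z in P, ‖f t‖ₑ ^ r := by rw [setLIntegral_const]
    _ ≤ ∫⁻ z in P, ∫⁻ θ, ‖f (t + circleMap 0 1 θ • (z - t))‖ₑ ^ r ∂μ :=
      lintegral_mono fun z => hpt z
    _ = ∫⁻ θ, (∫⁻ z in P, ‖f (t + circleMap 0 1 θ • (z - t))‖ₑ ^ r) ∂μ := by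
      refine lintegral_lintegral_swap (Measurable.aemeasurable ?_)
      have : Continuous fun p : (Fin d → ℂ) × ℝ => f (t + circleMap 0 1 p.2 • (p.1 - t)) := by
        fun_prop
      exact this.measurable.enorm.pow_const r
    _ = ∫⁻ z in P, ‖f z‖ₑ ^ r := by simp [hrot]

/-! ### Plancherel–Pólya inequality on slices -/

/-- The weighted arithmetic-geometric mean inequality in the form of Young's inequality. -/
theorem mul_rpow_sub_one_le {a b r : ℝ} (ha : 0 ≤ a) (hb : 0 ≤ b) (hr : 1 ≤ r) :
    a * b ^ (r - 1) ≤ r⁻¹ * a ^ r + (1 - r⁻¹) * b ^ r := by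
  have hr0 : 0 < r := by linarith
  have h := Real.geom_mean_le_arith_mean2_weighted (inv_nonneg.2 hr0.le)
    (sub_nonneg.2 (inv_le_one_of_one_le₀ hr)) (Real.rpow_nonneg ha r) (Real.rpow_nonneg hb r)
    (by ring)
  rwa [← Real.rpow_mul ha, ← Real.rpow_mul hb, mul_inv_cancel₀ hr0.ne', Real.rpow_one,
    show r * (1 - r⁻¹) = r - 1 by field_simp] at h

/-- The Plancherel–Pólya estimate on a compact set: translating a function of the Bernstein class
by `i y` increases the integral of `|f| ^ r` at most by the factor `exp (r ∑ σ_l |y_l|)`. -/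
theorem setIntegral_norm_rpow_le {d : ℕ} {σ : Fin d → ℝ} (hσ : ∀ l, 0 < σ l)
    {f : (Fin d → ℂ) → ℂ}
    (hf : IsOfExpTypeAtMost σ f) {r : ℝ} (hr : 1 ≤ r)
    (hint : Integrable fun x => ‖realRestrict f x‖ ^ r) (y : Fin d → ℝ)
    {K : Set (Fin d → ℝ)} (hK : IsCompact K) :
    ∫ x in K, ‖f fun l => (x l : ℂ) + Complex.I * y l‖ ^ r ≤
      Real.exp (r * ∑ l, σ l * |y l|) * ∫ x, ‖realRestrict f x‖ ^ r := by
  have hr0 : 0 < r := by linarith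
  obtain ⟨hd, hexp⟩ := hf
  have hcf := hd.continuous
  set τ : ℝ := ∑ l, σ l * |y l| with hτ
  set N : ℝ := ∫ x, ‖realRestrict f x‖ ^ r with hN
  set g : (Fin d → ℝ) → ℂ := fun x => f fun l => (x l : ℂ) + Complex.I * y l with hg
  have hgc : Continuous g := by fun_prop
  -- Dual function of `g`: `g φ = |g|^r`. When `r < 2` the power is negative, but the conjugate
  -- makes `φ` vanish at zeros of `g`.
  set φ : (Fin d → ℝ) → ℂ := fun x =>
    (starRingEnd ℂ) (g x) * ((‖g x‖ ^ (r - 2) : ℝ) : ℂ) with hφ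
  have hφn : ∀ x, ‖φ x‖ ≤ ‖g x‖ ^ (r - 1) := by
    intro x
    rcases eq_or_ne (g x) 0 with h0 | h0
    · simp only [hφ, h0, map_zero, zero_mul, norm_zero]
      exact Real.rpow_nonneg le_rfl _
    · have hp : 0 < ‖g x‖ := norm_pos_iff.2 h0
      simp only [hφ, norm_mul, RCLike.norm_conj, Complex.norm_real]
      rw [Real.norm_of_nonneg (Real.rpow_nonneg hp.le _)]
      nth_rewrite 1 [← Real.rpow_one ‖g x‖]
      rw [← Real.rpow_add hp]
      ring_nf
      rfl
  have hφg : ∀ x, g x * φ x = ((‖g x‖ ^ r : ℝ) : ℂ) := by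
    intro x
    rcases eq_or_ne (g x) 0 with h0 | h0
    · simp [h0, Real.zero_rpow hr0.ne']
    · have hp : 0 < ‖g x‖ := norm_pos_iff.2 h0
      simp only [hφ]
      rw [← mul_assoc, Complex.mul_conj, Complex.normSq_eq_norm_sq, ← Complex.ofReal_mul]
      congr 1
      rw [← Real.rpow_natCast, ← Real.rpow_add hp]
      norm_num
  have hgr : ∀ s : ℝ, 0 ≤ s → Continuous fun x => ‖g x‖ ^ s := fun s hs =>
    hgc.norm.rpow_const fun x => Or.inr hs
  have hφi : IntegrableOn φ K := by
    refine Integrable.mono' ((hgr (r - 1) (by linarith)).continuousOn.integrableOn_compact hK) ?_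
      (Filter.Eventually.of_forall hφn)
    have : Measurable φ := by
      have := hgc.measurable
      fun_prop
    exact this.aestronglyMeasurable
  set J : ℝ := ∫ x in K, ‖g x‖ ^ r with hJ
  have hJi : IntegrableOn (fun x => ‖g x‖ ^ r) K :=
    (hgr r hr0.le).continuousOn.integrableOn_compact hK
  set h : (Fin d → ℝ) → ℂ → ℂ := fun x w => f fun l => (x l : ℂ) + w * y l with hh
  have hhc : Continuous h.uncurry := by
    simp only [hh, Function.uncurry_def]
    fun_prop
  have hFd := differentiable_setIntegral_mul hhc
    (fun x => by simp only [hh]; fun_prop) hK hφi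
  set F : ℂ → ℂ := fun w => ∫ x in K, h x w * φ x with hF
  have hFI : F Complex.I = (J : ℂ) := by
    rw [hJ, ← integral_complex_ofReal]
    exact integral_congr_ae (Filter.Eventually.of_forall fun x => hφg x)
  have hgrowth : ∀ ε : ℝ, 0 < ε → ∃ A : ℝ, ∀ w, ‖F w‖ ≤ A * Real.exp ((τ + ε) * ‖w‖) := by
    intro ε hε
    set Y : ℝ := ∑ l, |y l| with hY
    have hY0 : 0 ≤ Y := Finset.sum_nonneg fun l _ => abs_nonneg _
    -- The extra type, summed over coordinates, is `η Y ≤ ε`; the `+ 1` covers `y = 0`.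
    set η : ℝ := ε / (Y + 1) with hη
    have hη0 : 0 < η := by positivity
    have hηY : η * Y ≤ ε := by
      rw [hη, div_mul_eq_mul_div, div_le_iff₀ (by linarith)]
      nlinarith
    obtain ⟨A, hA⟩ := hexp η hη0
    have hA0 : 0 ≤ A := by simpa using (norm_nonneg _).trans (hA 0)
    have hcont : Continuous fun x : Fin d → ℝ => A * Real.exp (∑ l, (σ l + η) * |x l|) := by
      fun_prop
    obtain ⟨B, hB⟩ := hK.exists_bound_of_continuousOn hcont.continuousOn
    refine ⟨B * ∫ x in K, ‖φ x‖, fun w => ?_⟩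
    have hle : ∀ x ∈ K, ‖h x w * φ x‖ ≤ B * Real.exp ((τ + ε) * ‖w‖) * ‖φ x‖ := by
      intro x hx
      rw [norm_mul]
      refine mul_le_mul_of_nonneg_right ?_ (norm_nonneg _)
      have hB' := (le_abs_self _).trans (hB x hx)
      refine (hA _).trans (le_trans ?_ (mul_le_mul_of_nonneg_right hB' (Real.exp_pos _).le))
      rw [mul_assoc, ← Real.exp_add]
      refine mul_le_mul_of_nonneg_left (Real.exp_le_exp.2 ?_) hA0
      calc ∑ l, (σ l + η) * ‖(x l : ℂ) + w * y l‖
          ≤ ∑ l, ((σ l + η) * |x l| + (σ l * |y l| + η * |y l|) * ‖w‖) := by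
            refine Finset.sum_le_sum fun l _ => ?_
            have := norm_add_le (x l : ℂ) (w * y l)
            rw [norm_mul, Complex.norm_real, Complex.norm_real, Real.norm_eq_abs,
              Real.norm_eq_abs] at this
            calc _ ≤ (σ l + η) * (|x l| + ‖w‖ * |y l|) :=
                  mul_le_mul_of_nonneg_left this (add_pos (hσ l) hη0).le
              _ = _ := by ring
        _ = ∑ l, (σ l + η) * |x l| + (τ + η * Y) * ‖w‖ := by
            rw [Finset.sum_add_distrib, ← Finset.sum_mul, Finset.sum_add_distrib,
              ← Finset.mul_sum]
        _ ≤ _ := by gcongr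
    calc ‖F w‖ ≤ ∫ x in K, B * Real.exp ((τ + ε) * ‖w‖) * ‖φ x‖ := by
          refine norm_integral_le_of_norm_le (hφi.norm.const_mul _) ?_
          filter_upwards [ae_restrict_mem hK.measurableSet] with x hx using hle x hx
      _ = _ := by rw [integral_const_mul]; ring
  -- Young's inequality stands in for Hölder. The weight `exp τ` offsets the later Phragmén–Lindelöf
  -- loss, so `J` keeps the coefficient `1 - r⁻¹ < 1`.
  have hreal : ∀ s : ℝ, Real.exp τ * ‖F s‖ ≤
      r⁻¹ * (Real.exp (r * τ) * N) + (1 - r⁻¹) * J := by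
    intro s
    have hshift : ∀ x, h x s = realRestrict f (x + s • y) := by
      intro x
      simp [hh, realRestrict]
    have hi1 : Integrable fun x => ‖realRestrict f (x + s • y)‖ ^ r := hint.comp_add_right (s • y)
    have hle : ∀ x, Real.exp τ * ‖h x s * φ x‖ ≤
        r⁻¹ * (Real.exp (r * τ) * ‖realRestrict f (x + s • y)‖ ^ r) +
          (1 - r⁻¹) * ‖g x‖ ^ r := by
      intro x
      have := mul_rpow_sub_one_le (a := Real.exp τ * ‖h x s‖) (b := ‖g x‖) (by positivity)
        (norm_nonneg _) hr
      rw [Real.mul_rpow (Real.exp_pos _).le (norm_nonneg _), ← Real.exp_mul, mul_comm τ r] at this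
      rw [← hshift]
      refine le_trans ?_ this
      rw [norm_mul, ← mul_assoc]
      exact mul_le_mul_of_nonneg_left (hφn x) (by positivity)
    have hir : IntegrableOn
        (fun x => r⁻¹ * (Real.exp (r * τ) * ‖realRestrict f (x + s • y)‖ ^ r)) K :=
      ((hi1.const_mul _).const_mul _).integrableOn
    have hig : IntegrableOn (fun x => (1 - r⁻¹) * ‖g x‖ ^ r) K := hJi.const_mul _
    calc Real.exp τ * ‖F s‖ = ‖∫ x in K, (Real.exp τ : ℂ) * (h x s * φ x)‖ := by
          rw [integral_const_mul, norm_mul, Complex.norm_of_nonneg (Real.exp_pos _).le]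
      _ ≤ ∫ x in K, (r⁻¹ * (Real.exp (r * τ) * ‖realRestrict f (x + s • y)‖ ^ r) +
          (1 - r⁻¹) * ‖g x‖ ^ r) := by
          refine norm_integral_le_of_norm_le (hir.add hig) (Filter.Eventually.of_forall fun x => ?_)
          rw [norm_mul, Complex.norm_of_nonneg (Real.exp_pos _).le]
          exact hle x
      _ = r⁻¹ * (Real.exp (r * τ) * ∫ x in K, ‖realRestrict f (x + s • y)‖ ^ r) +
          (1 - r⁻¹) * J := by
          rw [integral_add hir hig, integral_const_mul, integral_const_mul, integral_const_mul]
      _ ≤ _ := by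
          gcongr
          rw [hN, ← integral_add_right_eq_self (fun x => ‖realRestrict f x‖ ^ r) (s • y)]
          exact setIntegral_le_integral hi1
            (Filter.Eventually.of_forall fun x => Real.rpow_nonneg (norm_nonneg _) _)
  have hJ0 : 0 ≤ J := integral_nonneg fun x => Real.rpow_nonneg (norm_nonneg _) _
  have hfin := norm_apply_I_le_exp_mul hFd hgrowth
    (M := (Real.exp τ)⁻¹ * (r⁻¹ * (Real.exp (r * τ) * N) + (1 - r⁻¹) * J)) fun s => by
      rw [le_inv_mul_iff₀ (Real.exp_pos _)]
      exact hreal s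
  change ‖F Complex.I‖ ≤ _ at hfin
  rw [hFI, Complex.norm_of_nonneg hJ0, mul_inv_cancel_left₀ (Real.exp_pos _).ne'] at hfin
  -- The `J` term is absorbed on the left; its integrand is integrable because `K` is compact.
  have : r⁻¹ * J ≤ r⁻¹ * (Real.exp (r * τ) * N) := by linarith
  exact le_of_mul_le_mul_left this (inv_pos.2 hr0)

/-- The Plancherel–Pólya theorem: a translate by `i y` of a function in the Bernstein class is in
`L^r`, with norm at most `exp (∑ σ_l |y_l|)` times that of the function. -/
theorem lintegral_enorm_rpow_add_I_mul_le {d : ℕ} {σ : Fin d → ℝ} (hσ : ∀ l, 0 < σ l)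
    {f : (Fin d → ℂ) → ℂ}
    (hf : IsOfExpTypeAtMost σ f) {r : ℝ} (hr : 1 ≤ r)
    (hint : Integrable fun x => ‖realRestrict f x‖ ^ r) (y : Fin d → ℝ) :
    ∫⁻ x : Fin d → ℝ, ‖f fun l => (x l : ℂ) + Complex.I * y l‖ₑ ^ r ≤
      ENNReal.ofReal (Real.exp (r * ∑ l, σ l * |y l|) * ∫ x, ‖realRestrict f x‖ ^ r) := by
  have hr0 : 0 < r := by linarith
  have hcf := hf.1.continuous
  have hgc : Continuous fun x : Fin d → ℝ => f fun l => (x l : ℂ) + Complex.I * y l := by fun_prop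
  have hlim := (aecover_closedBall (μ := (volume : Measure (Fin d → ℝ))) (x := 0)
    tendsto_natCast_atTop_atTop).lintegral_tendsto_of_nat
    (f := fun x : Fin d → ℝ => ‖f fun l => (x l : ℂ) + Complex.I * y l‖ₑ ^ r)
    (hgc.measurable.enorm.pow_const r).aemeasurable
  refine le_of_tendsto' hlim fun n => ?_
  have hK := isCompact_closedBall (0 : Fin d → ℝ) n
  refine le_trans (le_of_eq ?_)
    (ENNReal.ofReal_le_ofReal (setIntegral_norm_rpow_le hσ hf hr hint y hK))
  rw [ofReal_integral_eq_lintegral_ofReal]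
  · refine lintegral_congr fun x => ?_
    rw [← ENNReal.ofReal_rpow_of_nonneg (norm_nonneg _) hr0.le, ofReal_norm]
  · exact (hgc.norm.rpow_const fun x => Or.inr hr0.le).continuousOn.integrableOn_compact hK
  · exact Filter.Eventually.of_forall fun x => Real.rpow_nonneg (norm_nonneg _) _

/-! ### Integration over tubes and boxes -/

/-- Integration over the tube `ℝ^d + i s` as an iterated integral. -/
theorem lintegral_tube_eq {d : ℕ} {F : (Fin d → ℂ) → ENNReal} (hF : Measurable F)
    {s : Set (Fin d → ℝ)} (hs : MeasurableSet s) :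
    ∫⁻ z in {z | (fun l => (z l).im) ∈ s}, F z =
      ∫⁻ y in s, ∫⁻ x : Fin d → ℝ, F fun l => (x l : ℂ) + Complex.I * y l := by
  have h1 : MeasurePreserving
      (fun (z : Fin d → ℂ) (l : Fin d) => Complex.measurableEquivRealProd (z l)) :=
    volume_preserving_pi fun _ => Complex.volume_preserving_equiv_real_prod
  have h2 := (volume_measurePreserving_arrowProdEquivProdArrow ℝ ℝ (Fin d)).comp h1
  set G : (Fin d → ℝ) × (Fin d → ℝ) → ENNReal :=
    fun p => F fun l => (p.1 l : ℂ) + Complex.I * p.2 l with hG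
  have hGm : Measurable G := by
    refine hF.comp ?_
    fun_prop
  have h3 := h2.setLIntegral_comp_preimage (MeasurableSet.univ.prod hs) hGm
  have h4 : (volume : Measure ((Fin d → ℝ) × (Fin d → ℝ))).restrict (Set.univ ×ˢ s) =
      (volume : Measure (Fin d → ℝ)).prod (volume.restrict s) := by
    rw [Measure.volume_eq_prod, ← Measure.prod_restrict, Measure.restrict_univ]
  rw [h4, lintegral_prod_symm _ hGm.aemeasurable] at h3
  rw [← h3]
  have h5 : {z : Fin d → ℂ | (fun l => (z l).im) ∈ s} =
      (⇑(MeasurableEquiv.arrowProdEquivProdArrow ℝ ℝ (Fin d)) ∘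
        fun (z : Fin d → ℂ) (l : Fin d) => Complex.measurableEquivRealProd (z l)) ⁻¹'
          (Set.univ ×ˢ s) := by
    ext z
    simp [MeasurableEquiv.arrowProdEquivProdArrow, Equiv.arrowProdEquivProdArrow]
  rw [← h5]
  refine lintegral_congr fun z => ?_
  simp only [hG, Function.comp]
  congr 1
  ext l
  simp [MeasurableEquiv.arrowProdEquivProdArrow, Equiv.arrowProdEquivProdArrow,
    mul_comm Complex.I, Complex.re_add_im]

/-- The integral of `exp (a |y|)` over a symmetric interval. -/
theorem integral_exp_mul_abs_Ioo {a : ℝ} (ha : 0 < a) {b : ℝ} (hb : 0 < b) :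
    ∫ y in Set.Ioo (-b) b, Real.exp (a * |y|) = 2 * ((Real.exp (a * b) - 1) / a) := by
  rw [← integral_Ioc_eq_integral_Ioo, ← intervalIntegral.integral_of_le (by linarith)]
  have hi : ∀ u v : ℝ, IntervalIntegrable (fun y => Real.exp (a * |y|)) volume u v := fun u v =>
    (by fun_prop : Continuous fun y : ℝ => Real.exp (a * |y|)).intervalIntegrable u v
  have hpos : ∫ y in (0 : ℝ)..b, Real.exp (a * |y|) = (Real.exp (a * b) - 1) / a := by
    have : ∫ y in (0 : ℝ)..b, Real.exp (a * |y|) = ∫ y in (0 : ℝ)..b, Real.exp (a * y) := by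
      refine intervalIntegral.integral_congr fun y hy => ?_
      rw [Set.uIcc_of_le hb.le] at hy
      simp only [abs_of_nonneg hy.1]
    rw [this, intervalIntegral.integral_comp_mul_left _ ha.ne', integral_exp]
    simp [div_eq_inv_mul]
  have hneg : ∫ y in (-b)..0, Real.exp (a * |y|) = (Real.exp (a * b) - 1) / a := by
    have := intervalIntegral.integral_comp_neg (a := 0) (b := b) fun y => Real.exp (a * |y|)
    simp only [abs_neg, neg_zero] at this
    rw [← this, hpos]
  rw [← intervalIntegral.integral_add_adjacent_intervals (hi (-b) 0) (hi 0 b), hneg, hpos]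
  ring

/-- The integral of `exp (∑ a_l |y_l|)` over a symmetric box. -/
theorem lintegral_exp_sum_mul_abs_box {d : ℕ} {a b : Fin d → ℝ} (ha : ∀ l, 0 < a l)
    (hb : ∀ l, 0 < b l) :
    ∫⁻ y in Set.univ.pi fun l => Set.Ioo (-b l) (b l),
        ENNReal.ofReal (Real.exp (∑ l, a l * |y l|)) =
      ENNReal.ofReal (∏ l, 2 * ((Real.exp (a l * b l) - 1) / a l)) := by
  rw [← ofReal_integral_eq_lintegral_ofReal]
  · congr 1
    simp_rw [Real.exp_sum]
    rw [volume_pi, Measure.restrict_pi_pi,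
      integral_fintype_prod_eq_prod (fun l (y : ℝ) => Real.exp (a l * |y|))]
    exact Finset.prod_congr rfl fun l _ => integral_exp_mul_abs_Ioo (ha l) (hb l)
  · have : Continuous fun y : Fin d → ℝ => Real.exp (∑ l, a l * |y l|) := by fun_prop
    refine (this.continuousOn.integrableOn_compact
      (isCompact_univ_pi fun l => isCompact_Icc (a := -b l) (b := b l))).mono_set ?_
    exact Set.pi_mono fun l _ => Set.Ioo_subset_Icc_self
  · exact Filter.Eventually.of_forall fun y => (Real.exp_pos _).le

/-! ### Summation over the sampling points -/

/-- The sub-mean value inequality summed over disjoint polydiscs centred at real points. -/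
theorem tsum_enorm_rpow_mul_le_lintegral_tube {d : ℕ} {δ : Fin d → ℝ}
    {t : Fin d → ℤ → ℝ} (ht : ∀ l, ∀ n m : ℤ, n ≠ m → δ l ≤ |t l n - t l m|)
    {f : (Fin d → ℂ) → ℂ} (hf : Differentiable ℂ f) {r : ℝ} (hr : 1 ≤ r) :
    (∑' n : Fin d → ℤ, ‖realRestrict f (fun l => t l (n l))‖ₑ ^ r) *
        ∏ l, ENNReal.ofReal (δ l / 2) ^ 2 * NNReal.pi ≤
      ∫⁻ z in {z : Fin d → ℂ | (fun l => (z l).im) ∈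
        Set.univ.pi fun l => Set.Ioo (-(δ l / 2)) (δ l / 2)}, ‖f z‖ₑ ^ r := by
  set P : (Fin d → ℤ) → Set (Fin d → ℂ) := fun n =>
    Set.univ.pi fun l => Metric.ball (t l (n l) : ℂ) (δ l / 2) with hP
  have hPm : ∀ n, MeasurableSet (P n) := fun n => MeasurableSet.univ_pi fun l => measurableSet_ball
  have hPv : ∀ n, volume (P n) = ∏ l, ENNReal.ofReal (δ l / 2) ^ 2 * NNReal.pi := by
    intro n
    simp only [hP, volume_pi_pi, Complex.volume_ball]
  have hPd : Pairwise (Function.onFun Disjoint P) := by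
    intro n m hnm
    obtain ⟨l, hl⟩ := Function.ne_iff.1 hnm
    refine Set.disjoint_univ_pi.2 ⟨l, Metric.ball_disjoint_ball ?_⟩
    rw [Complex.dist_of_im_eq (by simp), Complex.ofReal_re, Complex.ofReal_re, Real.dist_eq]
    linarith [ht l _ _ hl]
  rw [← ENNReal.tsum_mul_right]
  calc _ ≤ ∑' n, ∫⁻ z in P n, ‖f z‖ₑ ^ r := by
        refine ENNReal.tsum_le_tsum fun n => ?_
        rw [← hPv n]
        exact enorm_rpow_mul_volume_polydisc_le hf hr _ _
    _ = ∫⁻ z in ⋃ n, P n, ‖f z‖ₑ ^ r := (lintegral_iUnion hPm hPd _).symm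
    _ ≤ _ := by
        refine lintegral_mono_set (Set.iUnion_subset fun n z hz l _ => ?_)
        have h1 := hz l trivial
        rw [Metric.mem_ball, dist_eq_norm] at h1
        have h2 := (Complex.abs_im_le_norm _).trans_lt h1
        rw [Complex.sub_im, Complex.ofReal_im, sub_zero] at h2
        exact abs_lt.1 h2

theorem theorem1 {d : ℕ} (σ δ : Fin d → ℝ) (hσ : ∀ l, 0 < σ l) (hδ : ∀ l, 0 < δ l)
    (t : Fin d → ℤ → ℝ)
    (ht : ∀ l, ∀ n m : ℤ, n ≠ m → δ l ≤ |t l n - t l m|)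
    (r : ℝ) (hr : 1 ≤ r)
    (f : (Fin d → ℂ) → ℂ) (hf : f ∈ BernsteinClass σ r) :
    Summable (fun n : Fin d → ℤ => ‖realRestrict f (fun l => t l (n l))‖ ^ r) ∧
      ∑' n : Fin d → ℤ, ‖realRestrict f (fun l => t l (n l))‖ ^ r ≤
        plancherelPolyaConst σ δ r *
          (eLpNorm (realRestrict f) (ENNReal.ofReal r) volume).toReal ^ r := by
  obtain ⟨hexp, hLr⟩ := hf
  have hr0 : 0 < r := by linarith
  have hp0 : ENNReal.ofReal r ≠ 0 := by simpa using hr0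
  have hint : Integrable fun x => ‖realRestrict f x‖ ^ r := by
    have := hLr.integrable_norm_rpow hp0 ENNReal.ofReal_ne_top
    rwa [ENNReal.toReal_ofReal hr0.le] at this
  have hnorm : (eLpNorm (realRestrict f) (ENNReal.ofReal r) volume).toReal ^ r =
      ∫ x, ‖realRestrict f x‖ ^ r := by
    have hN : 0 ≤ ∫ x, ‖realRestrict f x‖ ^ r :=
      integral_nonneg fun x => Real.rpow_nonneg (norm_nonneg _) _
    rw [hLr.eLpNorm_eq_integral_rpow_norm hp0 ENNReal.ofReal_ne_top,
      ENNReal.toReal_ofReal hr0.le, ENNReal.toReal_ofReal (Real.rpow_nonneg hN _),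
      Real.rpow_inv_rpow hN hr0.ne']
  rw [hnorm]
  set N : ℝ := ∫ x, ‖realRestrict f x‖ ^ r with hN
  have hN0 : 0 ≤ N := integral_nonneg fun x => Real.rpow_nonneg (norm_nonneg _) _
  have hbox : MeasurableSet (Set.univ.pi fun l => Set.Ioo (-(δ l / 2)) (δ l / 2)) :=
    MeasurableSet.univ_pi fun l => measurableSet_Ioo
  have htube : ∫⁻ z in {z : Fin d → ℂ | (fun l => (z l).im) ∈
        Set.univ.pi fun l => Set.Ioo (-(δ l / 2)) (δ l / 2)}, ‖f z‖ₑ ^ r ≤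
      ENNReal.ofReal (∏ l, 2 * ((Real.exp (r * σ l * (δ l / 2)) - 1) / (r * σ l))) *
        ENNReal.ofReal N := by
    rw [lintegral_tube_eq (hexp.1.continuous.measurable.enorm.pow_const r) hbox,
      ← lintegral_exp_sum_mul_abs_box (fun l => mul_pos hr0 (hσ l)) (fun l => half_pos (hδ l)),
      ← lintegral_mul_const' _ _ ENNReal.ofReal_ne_top]
    refine lintegral_mono fun y => ?_
    refine (lintegral_enorm_rpow_add_I_mul_le hσ hexp hr hint y).trans (le_of_eq ?_)
    rw [← ENNReal.ofReal_mul (Real.exp_pos _).le, Finset.mul_sum]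
    simp only [mul_assoc, hN]
  set V : ℝ := ∏ l, (δ l / 2) ^ 2 * Real.pi with hV
  have hV0 : 0 < V := Finset.prod_pos fun l _ =>
    mul_pos (pow_pos (half_pos (hδ l)) 2) Real.pi_pos
  have hVe : ∏ l, ENNReal.ofReal (δ l / 2) ^ 2 * (NNReal.pi : ENNReal) = ENNReal.ofReal V := by
    rw [hV, ENNReal.ofReal_prod_of_nonneg fun l _ => by positivity]
    refine Finset.prod_congr rfl fun l _ => ?_
    rw [ENNReal.ofReal_mul (by positivity), ENNReal.ofReal_pow (half_pos (hδ l)).le,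
      ← NNReal.coe_real_pi, ENNReal.ofReal_coe_nnreal]
  -- Per coordinate, the box integral `2 (e^{r σ δ / 2} - 1) / (r σ)` divided by the disc area `π δ²
  -- / 4` produces the factor 8.
  have hconst : plancherelPolyaConst σ δ r * V =
      ∏ l, 2 * ((Real.exp (r * σ l * (δ l / 2)) - 1) / (r * σ l)) := by
    have hpow : (8 / (r * Real.pi)) ^ d = ∏ _l : Fin d, 8 / (r * Real.pi) := by
      rw [Finset.prod_const, Finset.card_univ, Fintype.card_fin]
    rw [plancherelPolyaConst, hV, hpow, ← Finset.prod_mul_distrib, ← Finset.prod_mul_distrib]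
    refine Finset.prod_congr rfl fun l _ => ?_
    have h1 := (hσ l).ne'
    have h2 := (hδ l).ne'
    have h3 := Real.pi_pos.ne'
    rw [show r * σ l * (δ l / 2) = r * δ l * σ l / 2 by ring]
    field_simp
    ring
  have hC0 : 0 ≤ plancherelPolyaConst σ δ r := by
    refine mul_nonneg (by positivity) (Finset.prod_nonneg fun l _ => ?_)
    have := hσ l
    have := hδ l
    have : 1 ≤ Real.exp (r * δ l * σ l / 2) := Real.one_le_exp (by positivity)
    exact div_nonneg (by linarith) (by positivity)
  -- Working in `ENNReal` lets the bound itself yield summability.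
  have hsum : ∑' n : Fin d → ℤ, ENNReal.ofReal (‖realRestrict f (fun l => t l (n l))‖ ^ r) ≤
      ENNReal.ofReal (plancherelPolyaConst σ δ r * N) := by
    have h := (tsum_enorm_rpow_mul_le_lintegral_tube ht hexp.1 hr).trans htube
    rw [hVe, ← hconst, ENNReal.ofReal_mul hC0, mul_right_comm,
      ENNReal.mul_le_mul_iff_left (by simpa using hV0) ENNReal.ofReal_ne_top,
      ← ENNReal.ofReal_mul hC0] at h
    simpa only [← ENNReal.ofReal_rpow_of_nonneg (norm_nonneg _) hr0.le, ofReal_norm] using h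
  have hnn : ∀ n : Fin d → ℤ, 0 ≤ ‖realRestrict f (fun l => t l (n l))‖ ^ r := fun n =>
    Real.rpow_nonneg (norm_nonneg _) _
  have hs : Summable fun n : Fin d → ℤ => ‖realRestrict f (fun l => t l (n l))‖ ^ r := by
    have := ENNReal.summable_toReal (hsum.trans_lt ENNReal.ofReal_lt_top).ne
    simpa only [ENNReal.toReal_ofReal (hnn _)] using this
  refine ⟨hs, ?_⟩
  rw [← ENNReal.ofReal_tsum_of_nonneg hnn hs] at hsum
  exact (ENNReal.ofReal_le_ofReal_iff (mul_nonneg hC0 hN0)).1 hsum
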